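/- Let $P\subset\mathbb{R}^3$ be the set of all triples $(x_3,x_2,x_1)$ of real numbers satisfying $x_3\le 4/9$, $x_2\le 1/2$, $x_3+x_1\le 2/3$, $x_3+3x_2/2\le 1$, $x_3+x_2+x_1\le 1$ and $x_3+x_2/6\le 1/2$. A finite simple graph $G$ is called subcubic if its maximum degree is at most three. Let $\nu(G)$ denote the maximum size of a matching in $G$, and let $n_i$ denote the number of vertices of degree $i$ in $G$. Let $(\alpha,\beta,\gamma)$ be an element of $P$. 1. If $\alpha\ge 0$, then $\nu(G)\ge\alpha n_3+\beta n_2+\gamma n_1-1$ for every connected subcubic graph $G$. 2. If $\alpha<0$, then $\nu(G)\ge\alpha n_3+\beta n_2+\gamma n_1-(2|\alpha|+1)$ for every connected subcubic graph $G$. -/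

import Mathlib

/-- A graph is subcubic if its maximum degree is at most three. -/
def IsSubcubic {V : Type*} [Fintype V] (G : SimpleGraph V) [DecidableRel G.Adj] : Prop :=
  ∀ v : V, G.degree v ≤ 3

/-- `numDegree G i` is `n_i`, the number of vertices of degree `i` in `G`. -/
def numDegree {V : Type*} [Fintype V] (G : SimpleGraph V) [DecidableRel G.Adj] (i : ℕ) : ℕ :=
  (Finset.univ.filter fun v : V => G.degree v = i).card

/-- The matching number `ν(G)`: the maximum number of edges of a matching in `G`.
The set is nonempty (the empty matching) and, for finite `G`, bounded, so that
the supremum is a maximum. -/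
noncomputable def matchingNumber {V : Type*} (G : SimpleGraph V) : ℕ :=
  sSup {k : ℕ | ∃ M : G.Subgraph, M.IsMatching ∧ M.edgeSet.ncard = k}

/-- The polyhedron `P` of triples `x = (x₃, x₂, x₁)` cut out by six half-spaces;
here `x₃ = x.1`, `x₂ = x.2.1` and `x₁ = x.2.2`. -/
def polyhedronP : Set (ℝ × ℝ × ℝ) :=
  {x | x.1 ≤ 4 / 9 ∧
    x.2.1 ≤ 1 / 2 ∧
    x.1 + x.2.2 ≤ 2 / 3 ∧
    x.1 + 3 * x.2.1 / 2 ≤ 1 ∧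
    x.1 + x.2.1 + x.2.2 ≤ 1 ∧
    x.1 + x.2.1 / 6 ≤ 1 / 2}

open Finset

/-! ### The Tutte–Berge barrier, obtained from Tutte's theorem -/

namespace SimpleGraph

/-! For `α ≥ 0` it is enough to treat five points (x₃, x₂, x₁): (4/9, 1/3, 2/9), (7/16, 3/8, 3/16),
(1/4, 1/2, 1/4), (0, 1/2, 1/2) and (0, 1/3, 2/3). Keeping its first coordinate, a point of
`polyhedronP` with `α ≥ 0` is dominated in the other two coordinates by a convex combination of
these (`le_of_mem_polyhedronP`), and n₂, n₁ are nonnegative.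

At each point, Tutte–Berge gives a set S with n - 2ν ≤ odd(G - S) - |S|. It remains to bound the
right side by a sum of vertex weights 1 - 2x_d plus 2, where d is the degree and x₀ = 0. This is
done by discharging (`Connected.discharge`): each component of G - S and each vertex of S satisfies
a local inequality, and these are added. The global input is that contracting the components leaves
a connected graph, so at least |S| + c - 1 edges join different parts, c being the number of
components.

For `α < 0`, the bound n₁ ≤ n₃ + 2 replaces (α, β, γ) by (0, β, γ + α) at the cost of 2|α|. -/

theorem Iso.ncard_oddComponents_eq {V W : Type*} [Finite W] {G : SimpleGraph V} {H : SimpleGraph W}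
    (φ : G ≃g H) : G.oddComponents.ncard = H.oddComponents.ncard := by
  refine Set.ncard_congr (fun c _ => φ.connectedComponentEquiv c) ?_ ?_ ?_
  · intro c hc
    have : c.supp.ncard = (φ.connectedComponentEquiv c).supp.ncard :=
      Nat.card_congr (ConnectedComponent.isoEquivSupp φ c)
    simpa [this] using hc
  · intro a b _ _ h
    exact φ.connectedComponentEquiv.injective h
  · intro c hc
    refine ⟨φ.connectedComponentEquiv.symm c, ?_, by simp⟩
    have : (φ.connectedComponentEquiv.symm c).supp.ncard =
        (φ.connectedComponentEquiv (φ.connectedComponentEquiv.symm c)).supp.ncard :=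
      Nat.card_congr (ConnectedComponent.isoEquivSupp φ _)
    change Odd _
    rw [this, Equiv.apply_symm_apply]
    exact hc

/-- Deleting a vertex set and inducing on its complement give isomorphic graphs. -/
def deleteVertsIsoInduce {V : Type*} (G : SimpleGraph V) (u : Set V) :
    ((⊤ : G.Subgraph).deleteVerts u).coe ≃g G.induce uᶜ where
  toEquiv := Equiv.subtypeEquivRight (by simp)
  map_rel_iff' := by
    rintro ⟨a, ha⟩ ⟨b, hb⟩
    simp at ha hb
    simp [ha, hb]

/-- The join of `G` with a complete graph on `W`. -/
def joinComplete {V : Type*} (G : SimpleGraph V) (W : Type*) : SimpleGraph (V ⊕ W) where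
  Adj a b := a ≠ b ∧ ∀ u v, a = .inl u → b = .inl v → G.Adj u v
  symm := ⟨fun _ _ h => ⟨h.1.symm, fun u v hu hv => (h.2 v u hv hu).symm⟩⟩
  loopless := ⟨fun _ h => h.1 rfl⟩

@[simp] theorem joinComplete_adj_inl {V W : Type*} (G : SimpleGraph V) (u v : V) :
    (G.joinComplete W).Adj (.inl u) (.inl v) ↔ G.Adj u v := by
  simp only [joinComplete, ne_eq, Sum.inl.injEq]
  exact ⟨fun h => h.2 u v rfl rfl, fun h => ⟨h.ne, fun a b ha hb => ha ▸ hb ▸ h⟩⟩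

theorem joinComplete_adj_inr {V W : Type*} (G : SimpleGraph V) {w : W} {a : V ⊕ W}
    (h : Sum.inr w ≠ a) : (G.joinComplete W).Adj (.inr w) a :=
  ⟨h, by simp⟩

/-- If some new vertex is not in `S`, deleting `S` from the join leaves at most one component. -/
theorem ncard_oddComponents_induce_joinComplete_le_one {V W : Type*} [Finite V] [Finite W]
    (G : SimpleGraph V) (S : Set (V ⊕ W)) {w : W} (hw : Sum.inr w ∉ S) :
    ((G.joinComplete W).induce Sᶜ).oddComponents.ncard ≤ 1 := by
  rw [Set.ncard_le_one_iff]
  have key : ∀ c : ((G.joinComplete W).induce Sᶜ).ConnectedComponent,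
      c = connectedComponentMk _ ⟨Sum.inr w, hw⟩ := by
    intro c
    induction c using ConnectedComponent.ind with
    | h v =>
      by_cases hv : v = ⟨Sum.inr w, hw⟩
      · rw [hv]
      · refine ConnectedComponent.sound (Adj.reachable ?_)
        refine (G.joinComplete_adj_inr ?_).symm
        intro h
        exact hv (Subtype.ext h.symm)
  intro a b _ _
  rw [key a, key b]

/-- If `S` contains all new vertices, deleting it from the join is deleting its trace from `G`. -/
noncomputable def induceJoinCompleteIso {V W : Type*} (G : SimpleGraph V) (S : Set (V ⊕ W))
    (hS : ∀ w, Sum.inr w ∈ S) :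
    G.induce (Sum.inl ⁻¹' S)ᶜ ≃g (G.joinComplete W).induce Sᶜ where
  toEquiv := Equiv.ofBijective (fun v => ⟨Sum.inl v.1, v.2⟩) <| by
    constructor
    · rintro ⟨a, ha⟩ ⟨b, hb⟩ h
      simpa using h
    · rintro ⟨a | b, h⟩
      · exact ⟨⟨a, h⟩, rfl⟩
      · exact absurd (hS b) h
  map_rel_iff' := by
    rintro ⟨a, ha⟩ ⟨b, hb⟩
    exact G.joinComplete_adj_inl a b

theorem Subgraph.IsMatching.ncard_verts_le {V : Type*} [Finite V] {G : SimpleGraph V}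
    {M : G.Subgraph} (hM : M.IsMatching) : M.verts.ncard ≤ 2 * M.edgeSet.ncard := by
  classical
  have hfin : M.edgeSet.Finite := Set.toFinite _
  rw [hM.verts_eq_biUnion_edgeSet, Set.ncard_eq_toFinset_card _ hfin, mul_comm]
  have : (⋃ e ∈ M.edgeSet, (e : Set V)) = ↑(hfin.toFinset.biUnion fun e : Sym2 V => e.toFinset) := by
    ext; simp
  rw [this, Set.ncard_coe_finset]
  refine Finset.card_biUnion_le_card_mul _ _ _ fun e _ => ?_
  induction e with
  | h a b => rw [Sym2.toFinset_mk_eq]; exact Finset.card_le_two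

theorem Subgraph.IsMatching.ncard_edgeSet_le_matchingNumber {V : Type*} [Finite V]
    {G : SimpleGraph V} {M : G.Subgraph} (hM : M.IsMatching) :
    M.edgeSet.ncard ≤ matchingNumber G := by
  refine le_csSup ⟨Nat.card (Sym2 V), ?_⟩ ⟨M, hM, rfl⟩
  rintro k ⟨M, -, rfl⟩
  exact Set.ncard_le_card _

/-- A perfect matching of the join yields a large matching of `G`. -/
theorem card_le_of_isPerfectMatching_joinComplete {V W : Type*} [Finite V] [Finite W]
    {G : SimpleGraph V} {M : (G.joinComplete W).Subgraph} (hM : M.IsPerfectMatching) :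
    Nat.card V ≤ 2 * matchingNumber G + Nat.card W := by
  classical
  let N : G.Subgraph :=
    { verts := {u | ∃ v, M.Adj (.inl u) (.inl v)}
      Adj := fun u v => M.Adj (.inl u) (.inl v)
      adj_sub := fun h => (G.joinComplete_adj_inl _ _).1 h.adj_sub
      edge_vert := fun h => ⟨_, h⟩
      symm := ⟨fun _ _ h => M.adj_symm h⟩ }
  have hN : N.IsMatching := by
    rintro u ⟨v, hv⟩
    exact ⟨v, hv, fun w hw => Sum.inl_injective (hM.1.eq_of_adj_left hw hv)⟩
  have hpartner : ∀ u : (N.vertsᶜ : Set V), ∃ w : W, M.Adj (.inl u) (.inr w) := by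
    rintro ⟨u, hu⟩
    obtain ⟨x, hx, -⟩ := (Subgraph.isPerfectMatching_iff.1 hM) (.inl u)
    rcases x with v | w
    · exact absurd ⟨v, hx⟩ hu
    · exact ⟨w, hx⟩
  choose f hf using hpartner
  have hcompl : (N.vertsᶜ).ncard ≤ Nat.card W := by
    refine Nat.card_le_card_of_injective f fun a b hab => ?_
    have hb := hf b
    rw [← hab] at hb
    exact Subtype.ext (Sum.inl_injective (hM.1.eq_of_adj_right (hf a) hb))
  have h1 := hN.ncard_verts_le
  have h2 := hN.ncard_edgeSet_le_matchingNumber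
  have h3 := Set.ncard_add_ncard_compl N.verts
  omega

/-- The **Tutte–Berge formula**, existence of a barrier. -/
theorem exists_card_add_ncard_le {V : Type*} [Finite V] (G : SimpleGraph V) :
    ∃ S : Set V, Nat.card V + S.ncard ≤
      2 * matchingNumber G + (G.induce Sᶜ).oddComponents.ncard := by
  have parity : ∀ {U : Type _} [Finite U] (H : SimpleGraph U) (S : Set U),
      (Odd (H.induce Sᶜ).oddComponents.ncard ↔ Odd (Nat.card U - S.ncard)) ∧
        S.ncard ≤ Nat.card U := by
    intro U _ H S
    have h3 := Set.ncard_add_ncard_compl S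
    rw [odd_ncard_oddComponents, Nat.card_coe_set_eq, ← h3]
    simp
  by_cases h : Nat.card V ≤ 2 * matchingNumber G + 1
  -- If n is odd there is an odd component; if n is even the hypothesis improves to n ≤ 2ν by
  -- parity.
  · refine ⟨∅, ?_⟩
    have := (parity G ∅).1
    simp only [Set.ncard_empty, Nat.sub_zero, Nat.odd_iff] at this ⊢
    omega
  -- With d = n - 2ν - 2 new vertices the join is just too small to have a perfect matching. Its
  -- order is even, so a Tutte violator has at least |S| + 2 odd components; the parity gain
  -- recovers the missing 2.
  · obtain ⟨d, hd⟩ : ∃ d, Nat.card V = 2 * matchingNumber G + 2 + d :=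
      ⟨_, (Nat.add_sub_of_le (by omega)).symm⟩
    have hno : ¬ ∃ M : (G.joinComplete (Fin d)).Subgraph, M.IsPerfectMatching := by
      rintro ⟨M, hM⟩
      have := card_le_of_isPerfectMatching_joinComplete hM
      rw [Nat.card_fin] at this
      omega
    rw [tutte] at hno
    push Not at hno
    obtain ⟨S, hS⟩ := hno
    rw [IsTutteViolator, (deleteVertsIsoInduce _ S).ncard_oddComponents_eq] at hS
    obtain ⟨hpar, hle⟩ := parity (G.joinComplete (Fin d)) S
    have hcard : Nat.card (V ⊕ Fin d) = Nat.card V + d := by simp [Nat.card_sum]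
    rw [Nat.odd_iff, Nat.odd_iff] at hpar
    -- A surviving new vertex is adjacent to everything left, whereas at least two odd components
    -- are needed.
    have hall : ∀ w, Sum.inr w ∈ S := by
      intro w
      by_contra hw
      have := ncard_oddComponents_induce_joinComplete_le_one G S hw
      omega
    refine ⟨Sum.inl ⁻¹' S, ?_⟩
    rw [(induceJoinCompleteIso G S hall).ncard_oddComponents_eq]
    have hSd : S.ncard = (Sum.inl ⁻¹' S : Set V).ncard + d := by
      have hunion : S = Sum.inl '' (Sum.inl ⁻¹' S : Set V) ∪ Set.range Sum.inr := by
        ext x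
        rcases x with v | w <;> simp [hall]
      conv_lhs => rw [hunion]
      rw [Set.ncard_union_eq, Set.ncard_image_of_injective _ Sum.inl_injective,
        ← Set.image_univ, Set.ncard_image_of_injective _ Sum.inr_injective, Set.ncard_univ,
        Nat.card_fin]
      rw [Set.disjoint_left]
      rintro _ ⟨a, _, rfl⟩ ⟨b, hb⟩
      cases hb
    omega

end SimpleGraph

/-! ### Edge counts for contractions and connected parts -/

namespace SimpleGraph

section Contraction

variable {V W : Type*} [Fintype V] [Fintype W] [DecidableEq W] (G : SimpleGraph V)
  [DecidableRel G.Adj]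

/-- The simple graph obtained from `G` by identifying the fibres of `φ`. -/
def contract {V W : Type*} (G : SimpleGraph V) (φ : V → W) : SimpleGraph W where
  Adj a b := a ≠ b ∧ ∃ u v, φ u = a ∧ φ v = b ∧ G.Adj u v
  symm := ⟨fun _ _ ⟨h, u, v, hu, hv, huv⟩ => ⟨h.symm, v, u, hv, hu, huv.symm⟩⟩
  loopless := ⟨fun _ h => h.1 rfl⟩

variable {G}

theorem Connected.contract {V W : Type*} {G : SimpleGraph V} (hG : G.Connected) {φ : V → W}
    (hφ : Function.Surjective φ) : (G.contract φ).Connected := by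
  have key : ∀ u v, G.Walk u v → (G.contract φ).Reachable (φ u) (φ v) := by
    intro u v p
    induction p with
    | nil => exact Reachable.refl _
    | @cons a b c hab _ ih =>
      by_cases h : φ a = φ b
      · rwa [h]
      · have hadj : (G.contract φ).Adj (φ a) (φ b) := ⟨h, a, b, rfl, rfl, hab⟩
        exact hadj.reachable.trans ih
  have : Nonempty W := hG.nonempty.map φ
  refine ⟨fun a b => ?_⟩
  obtain ⟨u, rfl⟩ := hφ a
  obtain ⟨v, rfl⟩ := hφ b
  exact key u v (hG.preconnected u v).some

/-- In a connected graph partitioned into `|W|` parts, the number of ordered pairs of adjacent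
vertices in different parts is at least `2 (|W| - 1)`. -/
theorem Connected.two_mul_card_le (hG : G.Connected) {φ : V → W} (hφ : Function.Surjective φ) :
    2 * Fintype.card W ≤ ∑ u, #{v ∈ G.neighborFinset u | φ v ≠ φ u} + 2 := by
  classical
  have h1 := (hG.contract hφ).card_vert_le_card_edgeSet_add_one
  rw [Nat.card_eq_fintype_card, Nat.card_eq_fintype_card, ← edgeFinset_card] at h1
  have h2 := (G.contract φ).sum_degrees_eq_twice_card_edges
  have h3 : ∑ a, (G.contract φ).degree a ≤ ∑ u, #{v ∈ G.neighborFinset u | φ v ≠ φ u} := by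
    simp_rw [← card_neighborFinset_eq_degree]
    rw [← card_sigma, ← card_sigma]
    -- Every adjacent ordered pair of the contraction lifts to one in `G`; parallel edges only help.
    refine card_le_card_of_surjOn (fun x => ⟨φ x.1, φ x.2⟩) ?_
    rintro ⟨a, b⟩ h
    simp only [coe_sigma, Set.mem_sigma_iff, coe_univ, Set.mem_univ, true_and, mem_coe,
      mem_neighborFinset] at h
    obtain ⟨hab, u, v, rfl, rfl, huv⟩ := h
    exact ⟨⟨u, v⟩, by simpa using ⟨huv, hab.symm⟩, rfl⟩
  omega

end Contraction

section Induce

variable {V : Type*} [Fintype V] [DecidableEq V] {G : SimpleGraph V} [DecidableRel G.Adj]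

/-- The degree sum over a set inducing a connected subgraph, split into internal edges and
the boundary. -/
theorem exists_sum_degree_eq_of_connected_induce {C : Finset V}
    (hC : (G.induce (C : Set V)).Connected) :
    ∃ e, ∑ u ∈ C, G.degree u = 2 * e + ∑ u ∈ C, #{v ∈ G.neighborFinset u | v ∉ C} ∧
      #C ≤ e + 1 ∧ 2 * e ≤ #C * (#C - 1) := by
  classical
  have hdeg : ∀ u : (C : Set V), (G.induce (C : Set V)).degree u =
      #{v ∈ G.neighborFinset u | v ∈ C} := by
    intro u
    rw [← card_neighborFinset_eq_degree]
    refine card_bij (fun v _ => v.1) (fun v hv => ?_) (fun _ _ _ _ h => Subtype.ext h)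
      (fun v hv => ?_)
    · simpa using hv
    · simp only [mem_filter, mem_neighborFinset] at hv
      exact ⟨⟨v, hv.2⟩, by simpa using hv.1, rfl⟩
  have hcard : Fintype.card (C : Set V) = #C := by simp
  refine ⟨#(G.induce (C : Set V)).edgeFinset, ?_, ?_, ?_⟩
  · rw [← sum_degrees_eq_twice_card_edges]
    simp_rw [hdeg]
    have : ∑ u : (C : Set V), #{v ∈ G.neighborFinset u | v ∈ C} =
        ∑ u ∈ C, #{v ∈ G.neighborFinset u | v ∈ C} :=
      sum_coe_sort C fun u => #{v ∈ G.neighborFinset u | v ∈ C}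
    rw [this, ← sum_add_distrib]
    refine sum_congr rfl fun u _ => ?_
    rw [← card_neighborFinset_eq_degree, card_filter_add_card_filter_not]
  · have := hC.card_vert_le_card_edgeSet_add_one
    rwa [Nat.card_eq_fintype_card, Nat.card_eq_fintype_card, ← edgeFinset_card, hcard] at this
  · have := (G.induce (C : Set V)).card_edgeFinset_le_card_choose_two
    rw [hcard, Nat.choose_two_right] at this
    have h2 := Nat.div_mul_le_self (#C * (#C - 1)) 2
    omega

theorem Connected.exists_boundary {V : Type*} {G : SimpleGraph V} (hG : G.Connected) {C : Set V}
    (hne : C.Nonempty) (hne' : Cᶜ.Nonempty) : ∃ u ∈ C, ∃ v ∉ C, G.Adj u v := by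
  obtain ⟨a, ha⟩ := hne
  obtain ⟨b, hb⟩ := hne'
  obtain ⟨d, -, h1, h2⟩ := (hG.preconnected a b).some.exists_boundary_dart C ha hb
  exact ⟨d.fst, h1, d.snd, h2, d.adj⟩

end Induce

/-! ### The partition into barrier vertices and components -/

section Partition

variable {V : Type*} (G : SimpleGraph V) (S : Finset V)

/-- The part containing a vertex in the partition of the vertices into the singletons of `S`
and the components left after deleting `S`. -/
noncomputable def barrierPart (v : V) :
    S ⊕ (G.induce (S : Set V)ᶜ).ConnectedComponent :=
  open Classical in
  if h : v ∈ S then .inl ⟨v, h⟩ else .inr (connectedComponentMk _ ⟨v, by simpa using h⟩)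

variable {G S}

theorem barrierPart_of_mem {v : V} (h : v ∈ S) : G.barrierPart S v = .inl ⟨v, h⟩ := dif_pos h

theorem barrierPart_of_notMem {v : V} (h : v ∉ S) :
    G.barrierPart S v = .inr (connectedComponentMk _ ⟨v, by simpa using h⟩) := dif_neg h

theorem barrierPart_eq_inl {v : V} {s : S} : G.barrierPart S v = .inl s ↔ v = s := by
  by_cases h : v ∈ S
  · rw [barrierPart_of_mem h, Sum.inl.injEq, Subtype.ext_iff]
  · rw [barrierPart_of_notMem h]
    simp only [reduceCtorEq, false_iff]
    rintro rfl
    exact h s.2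

theorem barrierPart_eq_inr {v : V} {c : (G.induce (S : Set V)ᶜ).ConnectedComponent} :
    G.barrierPart S v = .inr c ↔ ∃ h : v ∈ (S : Set V)ᶜ, connectedComponentMk _ ⟨v, h⟩ = c := by
  by_cases h : v ∈ S
  · rw [barrierPart_of_mem h]
    simp [h]
  · rw [barrierPart_of_notMem h]
    simp [h]

theorem barrierPart_surjective : Function.Surjective (G.barrierPart S) := by
  rintro (s | c)
  · exact ⟨s, barrierPart_of_mem s.2⟩
  · induction c using ConnectedComponent.ind with
    | h v => exact ⟨v, barrierPart_eq_inr.2 ⟨v.2, rfl⟩⟩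

theorem barrierPart_eq_of_adj {u v : V} (huv : G.Adj u v) (hu : u ∉ S) (hv : v ∉ S) :
    G.barrierPart S v = G.barrierPart S u := by
  rw [barrierPart_of_notMem hu, barrierPart_of_notMem hv]
  refine congrArg _ (ConnectedComponent.sound (Adj.reachable ?_))
  exact huv.symm

variable (G S) in
/-- The vertex set of a component left after deleting `S`. -/
noncomputable def barrierFiber [Fintype V] (c : (G.induce (S : Set V)ᶜ).ConnectedComponent) :
    Finset V :=
  open Classical in {v | G.barrierPart S v = .inr c}

variable [Fintype V]

theorem mem_barrierFiber {c : (G.induce (S : Set V)ᶜ).ConnectedComponent} {v : V} :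
    v ∈ G.barrierFiber S c ↔ G.barrierPart S v = .inr c := by
  simp [barrierFiber]

theorem notMem_of_mem_barrierFiber {c : (G.induce (S : Set V)ᶜ).ConnectedComponent} {v : V}
    (h : v ∈ G.barrierFiber S c) : v ∉ S :=
  fun hv => by
    rw [mem_barrierFiber, barrierPart_of_mem hv] at h
    cases h

theorem mem_barrierFiber_iff_of_adj {c : (G.induce (S : Set V)ᶜ).ConnectedComponent} {u v : V}
    (hu : u ∈ G.barrierFiber S c) (huv : G.Adj u v) : v ∉ G.barrierFiber S c ↔ v ∈ S := by
  refine ⟨fun h => ?_, fun h h' => notMem_of_mem_barrierFiber h' h⟩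
  by_contra hv
  rw [mem_barrierFiber] at hu h
  exact h ((barrierPart_eq_of_adj huv (notMem_of_mem_barrierFiber (mem_barrierFiber.2 hu)) hv).trans
    hu)

theorem coe_barrierFiber (c : (G.induce (S : Set V)ᶜ).ConnectedComponent) :
    (G.barrierFiber S c : Set V) = Subtype.val '' c.supp := by
  ext v
  rw [mem_coe, mem_barrierFiber, barrierPart_eq_inr]
  simp [ConnectedComponent.mem_supp_iff]

theorem card_barrierFiber (c : (G.induce (S : Set V)ᶜ).ConnectedComponent) :
    #(G.barrierFiber S c) = c.supp.ncard := by
  rw [← Set.ncard_coe_finset, coe_barrierFiber,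
    Set.ncard_image_of_injective _ Subtype.val_injective]

theorem connected_induce_barrierFiber (c : (G.induce (S : Set V)ᶜ).ConnectedComponent) :
    (G.induce (G.barrierFiber S c : Set V)).Connected := by
  rw [coe_barrierFiber]
  let f : c.toSimpleGraph →g G.induce (Subtype.val '' c.supp) :=
    { toFun := fun v => ⟨v.1.1, v.1, v.2, rfl⟩
      map_rel' := fun h => h }
  refine c.connected_toSimpleGraph.map f ?_
  rintro ⟨_, v, hv, rfl⟩
  exact ⟨⟨v, hv⟩, rfl⟩

theorem sum_eq_sum_add_sum_barrierFiber {M : Type*} [AddCommMonoid M]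
    [Fintype (G.induce (S : Set V)ᶜ).ConnectedComponent] (F : V → M) :
    ∑ v, F v = ∑ v ∈ S, F v + ∑ c, ∑ v ∈ G.barrierFiber S c, F v := by
  classical
  rw [← sum_fiberwise univ (G.barrierPart S) F, Fintype.sum_sum_type, ← sum_coe_sort S]
  congr 1
  refine sum_congr rfl fun s _ => ?_
  have : (univ.filter fun v => G.barrierPart S v = .inl s) = {s.1} := by
    ext v
    simp [barrierPart_eq_inl]
  rw [this, sum_singleton]

end Partition

end SimpleGraph

/-! ### Discharging over a barrier -/

namespace SimpleGraph

section Counting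

variable {V : Type*} [Fintype V] [DecidableEq V] {G : SimpleGraph V} [DecidableRel G.Adj]
  {S : Finset V}

variable (G S) in
/-- The number of edges joining a component left after deleting `S` to the rest of the graph. -/
noncomputable def barrierBoundary (c : (G.induce (S : Set V)ᶜ).ConnectedComponent) : ℕ :=
  ∑ u ∈ G.barrierFiber S c, #{v ∈ G.neighborFinset u | v ∉ G.barrierFiber S c}

theorem barrierBoundary_eq (c : (G.induce (S : Set V)ᶜ).ConnectedComponent) :
    G.barrierBoundary S c = ∑ u ∈ G.barrierFiber S c, #{v ∈ G.neighborFinset u | v ∈ S} := by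
  refine sum_congr rfl fun u hu => congrArg _ (filter_congr fun v hv => ?_)
  exact mem_barrierFiber_iff_of_adj hu ((G.mem_neighborFinset _ _).1 hv)

theorem Connected.one_le_barrierBoundary (hG : G.Connected) (hS : S.Nonempty)
    (c : (G.induce (S : Set V)ᶜ).ConnectedComponent) : 1 ≤ G.barrierBoundary S c := by
  obtain ⟨s, hs⟩ := hS
  obtain ⟨a, ha⟩ := barrierPart_surjective (G := G) (S := S) (.inr c)
  obtain ⟨u, hu, v, hv, huv⟩ := hG.exists_boundary (C := (G.barrierFiber S c : Set V))
    ⟨a, mem_barrierFiber.2 ha⟩ ⟨s, fun h => notMem_of_mem_barrierFiber h hs⟩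
  refine le_trans ?_ (single_le_sum (fun _ _ => Nat.zero_le _) hu)
  rw [Nat.succ_le_iff, card_pos]
  exact ⟨v, by simpa using ⟨huv, hv⟩⟩

variable [Fintype (G.induce (S : Set V)ᶜ).ConnectedComponent]

/-- An edge leaving a component ends in `S`. Double counting gives equality up to the edges inside
`S`. -/
theorem sum_barrierBoundary_le : ∑ c, G.barrierBoundary S c ≤ ∑ s ∈ S, G.degree s := by
  have h := sum_eq_sum_add_sum_barrierFiber (G := G) (S := S)
    fun u => #{v ∈ G.neighborFinset u | v ∈ S}
  simp_rw [← barrierBoundary_eq] at h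
  have h2 : ∑ u, #{v ∈ G.neighborFinset u | v ∈ S} = ∑ s ∈ S, G.degree s := by
    simp_rw [← card_neighborFinset_eq_degree, ← card_sigma]
    refine card_bij (fun x _ => ⟨x.2, x.1⟩) ?_ ?_ ?_
    · rintro ⟨u, v⟩ h
      simp at h ⊢
      exact ⟨h.2, h.1.symm⟩
    · rintro ⟨u, v⟩ _ ⟨u', v'⟩ _ h
      simp at h ⊢
      exact ⟨h.2, h.1⟩
    · rintro ⟨u, v⟩ h
      simp at h
      exact ⟨⟨v, u⟩, by simpa using ⟨h.2.symm, h.1⟩, rfl⟩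
  omega

/-- The tree bound for the contraction onto barrier vertices and components, with edges counted from
both ends. -/
theorem Connected.two_mul_barrier_le (hG : G.Connected) :
    2 * (#S + Fintype.card (G.induce (S : Set V)ᶜ).ConnectedComponent) ≤
      ∑ c, G.barrierBoundary S c + ∑ s ∈ S, G.degree s + 2 := by
  classical
  have h := hG.two_mul_card_le (barrierPart_surjective (G := G) (S := S))
  rw [Fintype.card_sum, Fintype.card_coe, sum_eq_sum_add_sum_barrierFiber (G := G) (S := S)] at h
  have h1 : ∑ u ∈ S, #{v ∈ G.neighborFinset u | G.barrierPart S v ≠ G.barrierPart S u} ≤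
      ∑ s ∈ S, G.degree s := by
    refine sum_le_sum fun u _ => ?_
    rw [← card_neighborFinset_eq_degree]
    exact card_filter_le _ _
  have h2 : ∑ c, ∑ u ∈ G.barrierFiber S c,
      #{v ∈ G.neighborFinset u | G.barrierPart S v ≠ G.barrierPart S u} =
      ∑ c, G.barrierBoundary S c := by
    refine sum_congr rfl fun c _ => sum_congr rfl fun u hu => congrArg _ (filter_congr fun v _ => ?_)
    rw [mem_barrierFiber] at hu ⊢
    rw [hu]
  omega

/-- Discharging: local inequalities with vertex weights `h`, edge weight `θ` and connectivity
weight `τ` imply a lower bound for the deficiency of a barrier. -/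
theorem Connected.discharge (hG : G.Connected) (hS : S.Nonempty) (h : ℕ → ℤ) {N τ θ : ℤ}
    (hτ0 : 0 ≤ τ) (hτ : τ ≤ 2 * N) (hτθ : 2 * θ ≤ τ)
    (hbarrier : ∀ v, (τ - θ) * G.degree v - τ ≤ h (G.degree v) + N)
    (hcomp : ∀ (C : Finset V) (e k : ℕ), C.Nonempty → #C ≤ e + 1 → 2 * e ≤ #C * (#C - 1) →
      ∑ v ∈ C, G.degree v = 2 * e + k → 1 ≤ k →
      θ * k - τ ≤ ∑ v ∈ C, h (G.degree v) - if Odd #C then N else 0) :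
    N * (G.induce (S : Set V)ᶜ).oddComponents.ncard ≤
      ∑ v, h (G.degree v) + N * #S + 2 * N := by
  classical
  have hlocal : ∀ c : (G.induce (S : Set V)ᶜ).ConnectedComponent,
      θ * G.barrierBoundary S c - τ ≤
        ∑ v ∈ G.barrierFiber S c, h (G.degree v) - if Odd c.supp.ncard then N else 0 := by
    intro c
    obtain ⟨e, h1, h2, h3⟩ :=
      exists_sum_degree_eq_of_connected_induce (connected_induce_barrierFiber c)
    rw [← card_barrierFiber]
    refine hcomp _ e _ ?_ h2 h3 h1 (hG.one_le_barrierBoundary hS c)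
    rw [← card_pos, card_barrierFiber, Set.ncard_pos]
    exact c.nonempty_supp
  have hsum := sum_le_sum fun c (_ : c ∈ univ) => hlocal c
  have hbar := sum_le_sum fun v (_ : v ∈ S) => hbarrier v
  rw [sum_sub_distrib, sum_sub_distrib, ← mul_sum, sum_const, card_univ, ← sum_filter, sum_const]
    at hsum
  rw [sum_sub_distrib, sum_add_distrib, ← mul_sum, sum_const, sum_const] at hbar
  have hodd : (G.induce (S : Set V)ᶜ).oddComponents.ncard =
      #{c : (G.induce (S : Set V)ᶜ).ConnectedComponent | Odd c.supp.ncard} := by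
    rw [← Set.ncard_coe_finset]
    simp
  have hsplit := sum_eq_sum_add_sum_barrierFiber (G := G) (S := S) fun v => h (G.degree v)
  have hq := sum_barrierBoundary_le (G := G) (S := S)
  have htree := hG.two_mul_barrier_le (S := S)
  zify at hq htree
  simp only [nsmul_eq_mul] at hsum hbar
  rw [hodd, hsplit]
  -- Let B be the total boundary and D the degree sum over `S`. The added local inequalities have
  -- left side θB + (τ - θ)D - τ(|S| + c). By the tree bound this is at least (τ/2 - θ)(D - B) - τ,
  -- hence at least -τ ≥ -2N.
  nlinarith [mul_nonneg (sub_nonneg.2 hτθ) (sub_nonneg.2 hq),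
    mul_nonneg hτ0 (sub_nonneg.2 htree)]

end Counting

section Bound

variable {V : Type*} [Fintype V] {G : SimpleGraph V} [DecidableRel G.Adj]

/-- Local inequalities for the vertex weights `h` imply a lower bound on the matching number. -/
theorem Connected.weighted_le_matchingNumber (hG : G.Connected) (h : ℕ → ℤ) {N τ θ : ℤ}
    (hτ0 : 0 ≤ τ) (hτ : τ ≤ 2 * N) (hτθ : 2 * θ ≤ τ)
    (hbarrier : ∀ v, (τ - θ) * G.degree v - τ ≤ h (G.degree v) + N)
    (hcomp : ∀ (C : Finset V) (e k : ℕ), C.Nonempty → #C ≤ e + 1 → 2 * e ≤ #C * (#C - 1) →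
      ∑ v ∈ C, G.degree v = 2 * e + k → 1 ≤ k →
      θ * k - τ ≤ ∑ v ∈ C, h (G.degree v) - if Odd #C then N else 0)
    (huniv : ∀ e : ℕ, Fintype.card V ≤ e + 1 → ∑ v, G.degree v = 2 * e →
      -N ≤ ∑ v, h (G.degree v)) :
    ∑ v, (N - h (G.degree v)) ≤ 2 * N * (matchingNumber G + 1) := by
  classical
  have hN : 0 ≤ N := by omega
  obtain ⟨S, hS⟩ := G.exists_card_add_ncard_le
  lift S to Finset V using S.toFinite
  rw [Set.ncard_coe_finset, Nat.card_eq_fintype_card] at hS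
  have key : N * (G.induce (S : Set V)ᶜ).oddComponents.ncard ≤
      ∑ v, h (G.degree v) + N * #S + 2 * N := by
    -- The empty barrier is separate because its component has no boundary edge, so `hcomp` with `1
    -- ≤ k` does not apply; `huniv` replaces it.
    rcases S.eq_empty_or_nonempty with rfl | hne
    · have hone := hG.two_mul_barrier_le (S := ∅)
      have hzero := sum_barrierBoundary_le (G := G) (S := ∅)
      have hle := Set.ncard_le_card (G.induce ((∅ : Finset V) : Set V)ᶜ).oddComponents
      rw [Nat.card_eq_fintype_card] at hle
      simp only [card_empty, sum_empty] at hone hzero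
      have hle1 : ((G.induce ((∅ : Finset V) : Set V)ᶜ).oddComponents.ncard : ℤ) ≤ 1 := by
        exact_mod_cast (by omega : (G.induce ((∅ : Finset V) : Set V)ᶜ).oddComponents.ncard ≤ 1)
      have hcard := hG.card_vert_le_card_edgeSet_add_one
      rw [Nat.card_eq_fintype_card, Nat.card_eq_fintype_card, ← edgeFinset_card] at hcard
      have := huniv _ hcard G.sum_degrees_eq_twice_card_edges
      simp only [card_empty, Nat.cast_zero, mul_zero, add_zero]
      nlinarith [mul_nonneg hN (sub_nonneg.2 hle1)]
    · exact hG.discharge hne h hτ0 hτ hτθ hbarrier hcomp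
  rw [sum_sub_distrib, sum_const, card_univ, nsmul_eq_mul]
  zify at hS
  nlinarith [mul_nonneg hN (sub_nonneg.2 hS)]

end Bound

end SimpleGraph

/-! ### The five extremal inequalities -/

namespace SimpleGraph

section Extremal

variable {V : Type*} [Fintype V] {G : SimpleGraph V} [DecidableRel G.Adj]

/-- A linear lower bound for vertex weights gives one for their sum. -/
theorem linear_le_sum_of_degree_le (hsub : IsSubcubic G) {h : ℕ → ℤ} {a b : ℤ}
    (hab : ∀ d ≤ 3, a - b * d ≤ h d) (C : Finset V) {D : ℕ} (hD : ∑ v ∈ C, G.degree v = D) :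
    a * #C - b * D ≤ ∑ v ∈ C, h (G.degree v) := by
  have := sum_le_sum fun v (_ : v ∈ C) => hab _ (hsub v)
  rw [sum_sub_distrib, sum_const, ← mul_sum, nsmul_eq_mul] at this
  rw [← hD]
  push_cast
  linarith

theorem sum_eq_numDegree (hsub : IsSubcubic G) (f : ℕ → ℤ) (h0 : f 0 = 0) :
    ∑ v, f (G.degree v) =
      f 3 * numDegree G 3 + f 2 * numDegree G 2 + f 1 * numDegree G 1 := by
  have key : ∀ v, f (G.degree v) = f 3 * (if G.degree v = 3 then 1 else 0) +
      f 2 * (if G.degree v = 2 then 1 else 0) + f 1 * (if G.degree v = 1 then 1 else 0) := by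
    intro v
    have := hsub v
    generalize G.degree v = d at *
    interval_cases d <;> simp [h0]
  simp_rw [key, sum_add_distrib, ← mul_sum, numDegree, card_filter]
  push_cast
  rfl

/-- The point (4/9, 1/3, 2/9). As in all five bounds, h(d) = N(1 - 2x_d), with N clearing
denominators and h(0) = N so that isolated vertices count zero. -/
theorem Connected.four_ninths_bound (hG : G.Connected) (hsub : IsSubcubic G) :
    8 * (numDegree G 3 : ℤ) + 6 * numDegree G 2 + 4 * numDegree G 1 ≤
      18 * (matchingNumber G + 1) := by
  obtain ⟨h, h0, h1, h2, h3⟩ : ∃ h : ℕ → ℤ, h 0 = 9 ∧ h 1 = 5 ∧ h 2 = 3 ∧ h 3 = 1 :=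
    ⟨fun d => if d = 0 then 9 else if d = 1 then 5 else if d = 2 then 3 else 1, by simp⟩
  have main := hG.weighted_le_matchingNumber h (N := 9) (τ := 2) (θ := -2)
    (by norm_num) (by norm_num) (by norm_num) (fun v => ?_) (fun C e k hne hm he hD hk => ?_)
    (fun e hm hD => ?_)
  · rw [sum_eq_numDegree hsub (fun d => 9 - h d) (by simp [h0])] at main
    simp only [h1, h2, h3] at main
    linarith
  · have := hsub v
    generalize G.degree v = d at *
    interval_cases d <;> simp [h0, h1, h2, h3]
  · have hpos := hne.card_pos
    have lin₁ := linear_le_sum_of_degree_le hsub (h := h) (a := 7) (b := 2)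
      (fun d hd => by interval_cases d <;> simp [h0, h1, h2, h3]) C hD
    have lin₂ := linear_le_sum_of_degree_le hsub (h := h) (a := 1) (b := 0)
      (fun d hd => by interval_cases d <;> simp [h0, h1, h2, h3]) C hD
    split_ifs with hodd
    -- The requirement is Σh + 2k ≥ 7. Sizes 1 and 3 follow from 7|C| - 4e with e ≤ 0 and e ≤ 3;
    -- from size 5 on, Σh ≥ |C| and k ≥ 1 suffice.
    · obtain hm1 | hm3 | hm5 : #C = 1 ∨ #C = 3 ∨ 5 ≤ #C := by
        obtain ⟨r, hr⟩ := hodd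
        omega
      · rw [hm1] at he lin₁ lin₂
        push_cast at lin₁ lin₂
        omega
      · rw [hm3] at he lin₁ lin₂
        push_cast at lin₁ lin₂
        omega
      · push_cast at lin₁ lin₂
        omega
    · push_cast at lin₁ lin₂
      omega
  · have := linear_le_sum_of_degree_le hsub (h := h) (a := 0) (b := 0)
      (fun d hd => by interval_cases d <;> simp [h0, h1, h2, h3]) univ hD
    rw [card_univ] at this
    push_cast at this
    linarith


/-- The point (7/16, 3/8, 3/16). An odd component needs Σh + 3k ≥ 8; sizes 1, 3 and at least 5 use
the minorants 8 - 3d, 4 - d and 1 respectively. -/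
theorem Connected.seven_sixteenths_bound (hG : G.Connected) (hsub : IsSubcubic G) :
    7 * (numDegree G 3 : ℤ) + 6 * numDegree G 2 + 3 * numDegree G 1 ≤
      16 * (matchingNumber G + 1) := by
  obtain ⟨h, h0, h1, h2, h3⟩ : ∃ h : ℕ → ℤ, h 0 = 8 ∧ h 1 = 5 ∧ h 2 = 2 ∧ h 3 = 1 :=
    ⟨fun d => if d = 0 then 8 else if d = 1 then 5 else if d = 2 then 2 else 1, by simp⟩
  have main := hG.weighted_le_matchingNumber h (N := 8) (τ := 0) (θ := -3)
    (by norm_num) (by norm_num) (by norm_num) (fun v => ?_) (fun C e k hne hm he hD hk => ?_)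
    (fun e hm hD => ?_)
  · rw [sum_eq_numDegree hsub (fun d => 8 - h d) (by simp [h0])] at main
    simp only [h1, h2, h3] at main
    linarith
  · have := hsub v
    generalize G.degree v = d at *
    interval_cases d <;> simp [h0, h1, h2, h3]
  · have hpos := hne.card_pos
    have lin₁ := linear_le_sum_of_degree_le hsub (h := h) (a := 8) (b := 3)
      (fun d hd => by interval_cases d <;> simp [h0, h1, h2, h3]) C hD
    have lin₂ := linear_le_sum_of_degree_le hsub (h := h) (a := 4) (b := 1)
      (fun d hd => by interval_cases d <;> simp [h0, h1, h2, h3]) C hD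
    have lin₃ := linear_le_sum_of_degree_le hsub (h := h) (a := 1) (b := 0)
      (fun d hd => by interval_cases d <;> simp [h0, h1, h2, h3]) C hD
    split_ifs with hodd
    · obtain hm1 | hm3 | hm5 : #C = 1 ∨ #C = 3 ∨ 5 ≤ #C := by
        obtain ⟨r, hr⟩ := hodd
        omega
      · rw [hm1] at he lin₁ lin₂ lin₃
        push_cast at lin₁ lin₂ lin₃
        omega
      · rw [hm3] at he lin₁ lin₂ lin₃
        push_cast at lin₁ lin₂ lin₃
        omega
      · push_cast at lin₁ lin₂ lin₃
        omega
    · push_cast at lin₁ lin₂ lin₃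
      omega
  · have := linear_le_sum_of_degree_le hsub (h := h) (a := 0) (b := 0)
      (fun d hd => by interval_cases d <;> simp [h0, h1, h2, h3]) univ hD
    rw [card_univ] at this
    push_cast at this
    linarith


/-- The point (1/4, 1/2, 1/4). An odd component needs Σh + k ≥ 2, and only k = 1 with Σh = 0 could
fail. -/
theorem Connected.one_quarter_bound (hG : G.Connected) (hsub : IsSubcubic G) :
    (numDegree G 3 : ℤ) + 2 * numDegree G 2 + numDegree G 1 ≤
      4 * (matchingNumber G + 1) := by
  obtain ⟨h, h0, h1, h2, h3⟩ : ∃ h : ℕ → ℤ, h 0 = 2 ∧ h 1 = 1 ∧ h 2 = 0 ∧ h 3 = 1 :=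
    ⟨fun d => if d = 0 then 2 else if d = 1 then 1 else if d = 2 then 0 else 1, by simp⟩
  have main := hG.weighted_le_matchingNumber h (N := 2) (τ := 0) (θ := -1)
    (by norm_num) (by norm_num) (by norm_num) (fun v => ?_) (fun C e k hne hm he hD hk => ?_)
    (fun e hm hD => ?_)
  · rw [sum_eq_numDegree hsub (fun d => 2 - h d) (by simp [h0])] at main
    simp only [h1, h2, h3] at main
    linarith
  · have := hsub v
    generalize G.degree v = d at *
    interval_cases d <;> simp [h0, h1, h2, h3]
  · have lin₁ := linear_le_sum_of_degree_le hsub (h := h) (a := 0) (b := 0)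
      (fun d hd => by interval_cases d <;> simp [h0, h1, h2, h3]) C hD
    -- Since h(d) ≡ d mod 2, the sum Σh has the parity of 2e + k, which excludes k = 1 with Σh = 0.
    have hparity : ∑ v ∈ C, h (G.degree v) ≡ ∑ v ∈ C, (G.degree v : ℤ) [ZMOD 2] := by
      refine Int.ModEq.sum fun v _ => ?_
      have := hsub v
      generalize G.degree v = d at *
      interval_cases d <;> simp [h0, h1, h2, h3, Int.ModEq]
    rw [← Nat.cast_sum, hD] at hparity
    unfold Int.ModEq at hparity
    push_cast at lin₁ hparity
    split_ifs <;> omega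
  · have := linear_le_sum_of_degree_le hsub (h := h) (a := 0) (b := 0)
      (fun d hd => by interval_cases d <;> simp [h0, h1, h2, h3]) univ hD
    rw [card_univ] at this
    push_cast at this
    linarith


/-- The point (0, 1/2, 1/2). Here θ = 0, and nonnegativity of the weights settles every component.
-/
theorem Connected.one_half_bound (hG : G.Connected) (hsub : IsSubcubic G) :
    (numDegree G 2 : ℤ) + numDegree G 1 ≤ 2 * (matchingNumber G + 1) := by
  obtain ⟨h, h0, h1, h2, h3⟩ : ∃ h : ℕ → ℤ, h 0 = 1 ∧ h 1 = 0 ∧ h 2 = 0 ∧ h 3 = 1 :=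
    ⟨fun d => if d = 0 then 1 else if d = 1 then 0 else if d = 2 then 0 else 1, by simp⟩
  have main := hG.weighted_le_matchingNumber h (N := 1) (τ := 1) (θ := 0)
    (by norm_num) (by norm_num) (by norm_num) (fun v => ?_) (fun C e k hne hm he hD hk => ?_)
    (fun e hm hD => ?_)
  · rw [sum_eq_numDegree hsub (fun d => 1 - h d) (by simp [h0])] at main
    simp only [h1, h2, h3] at main
    linarith
  · have := hsub v
    generalize G.degree v = d at *
    interval_cases d <;> simp [h0, h1, h2, h3]
  · have lin₁ := linear_le_sum_of_degree_le hsub (h := h) (a := 0) (b := 0)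
      (fun d hd => by interval_cases d <;> simp [h0, h1, h2, h3]) C hD
    split_ifs <;> omega
  · have := linear_le_sum_of_degree_le hsub (h := h) (a := 0) (b := 0)
      (fun d hd => by interval_cases d <;> simp [h0, h1, h2, h3]) univ hD
    rw [card_univ] at this
    push_cast at this
    linarith


/-- The point (0, 1/3, 2/3). Leaves have negative weight, so the connectivity bound e ≥ |C| - 1 is
essential: h(d) ≥ 2d - 3 gives Σh ≥ |C| - 4 + 2k. -/
theorem Connected.one_third_bound (hG : G.Connected) (hsub : IsSubcubic G) :
    2 * (numDegree G 2 : ℤ) + 4 * numDegree G 1 ≤ 6 * (matchingNumber G + 1) := by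
  obtain ⟨h, h0, h1, h2, h3⟩ : ∃ h : ℕ → ℤ, h 0 = 3 ∧ h 1 = -1 ∧ h 2 = 1 ∧ h 3 = 3 :=
    ⟨fun d => if d = 0 then 3 else if d = 1 then -1 else if d = 2 then 1 else 3, by simp⟩
  have main := hG.weighted_le_matchingNumber h (N := 3) (τ := 6) (θ := 2)
    (by norm_num) (by norm_num) (by norm_num) (fun v => ?_) (fun C e k hne hm he hD hk => ?_)
    (fun e hm hD => ?_)
  · rw [sum_eq_numDegree hsub (fun d => 3 - h d) (by simp [h0])] at main
    simp only [h1, h2, h3] at main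
    linarith
  · have := hsub v
    generalize G.degree v = d at *
    interval_cases d <;> simp [h0, h1, h2, h3]
  · have hpos := hne.card_pos
    have lin₁ := linear_le_sum_of_degree_le hsub (h := h) (a := -3) (b := -2)
      (fun d hd => by interval_cases d <;> simp [h0, h1, h2, h3]) C hD
    push_cast at lin₁
    split_ifs <;> omega
  · have hpos : 0 < Fintype.card V := Fintype.card_pos_iff.2 hG.nonempty
    have lin₁ := linear_le_sum_of_degree_le hsub (h := h) (a := -3) (b := -2)
      (fun d hd => by interval_cases d <;> simp [h0, h1, h2, h3]) univ hD
    rw [card_univ] at lin₁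
    push_cast at lin₁
    omega


/-- Summing d - 2 over all vertices gives 2|E| - 2n ≥ -2 by connectivity. -/
theorem Connected.numDegree_one_le (hG : G.Connected) (hsub : IsSubcubic G) :
    (numDegree G 1 : ℤ) ≤ numDegree G 3 + 2 := by
  have hcard := hG.card_vert_le_card_edgeSet_add_one
  rw [Nat.card_eq_fintype_card, Nat.card_eq_fintype_card, ← edgeFinset_card] at hcard
  have hsum := G.sum_degrees_eq_twice_card_edges
  obtain ⟨h, h0, h1, h2, h3⟩ : ∃ h : ℕ → ℤ, h 0 = 0 ∧ h 1 = -1 ∧ h 2 = 0 ∧ h 3 = 1 :=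
    ⟨fun d => if d = 0 then 0 else if d = 1 then -1 else if d = 2 then 0 else 1, by simp⟩
  have lin := linear_le_sum_of_degree_le hsub (h := h) (a := -2) (b := -1)
    (fun d hd => by interval_cases d <;> simp [h0, h1, h2, h3]) univ hsum
  rw [sum_eq_numDegree hsub h h0, h1, h2, h3, card_univ] at lin
  push_cast at lin
  omega

end Extremal

end SimpleGraph

/-! ### From the five points to the polyhedron -/

/-- The part of `polyhedronP` with nonnegative first coordinate lies below the convex hull of five
points; hence bounds at those points give bounds on the whole part. -/
theorem le_of_mem_polyhedronP {α β γ a b c t : ℝ} (hP : (α, β, γ) ∈ polyhedronP) (hα : 0 ≤ α)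
    (hb : 0 ≤ b) (hc : 0 ≤ c)
    (h₁ : 8 * a + 6 * b + 4 * c ≤ 18 * t) (h₂ : 7 * a + 6 * b + 3 * c ≤ 16 * t)
    (h₃ : a + 2 * b + c ≤ 4 * t) (h₄ : b + c ≤ 2 * t) (h₅ : 2 * b + 4 * c ≤ 6 * t) :
    α * a + β * b + γ * c ≤ t := by
  obtain ⟨hp₁, hp₂, hp₃, hp₄, hp₅, hp₆⟩ := hP
  simp only at hp₁ hp₂ hp₃ hp₄ hp₅ hp₆
  -- Write p₁, …, p₅ for the points of `h₁`, …, `h₅`. For β ≤ 1/3 the segment p₁p₅ dominates, with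
  -- weights 9α/4 and 1 - 9α/4. Above it, the (α, β)-region splits into the triangles p₁p₄p₅, p₁p₂p₄
  -- and p₂p₃p₄; the multipliers are scaled barycentric coordinates. All five points satisfy x₃ + x₂
  -- + x₁ = 1, so `ec` absorbs the slack in γ.
  rcases le_total β (1 / 3) with hβ | hβ
  · have e₁ := mul_nonneg hα (sub_nonneg.2 h₁)
    have e₂ := mul_nonneg (sub_nonneg.2 hp₁) (sub_nonneg.2 h₅)
    have e₃ := mul_nonneg (sub_nonneg.2 hβ) hb
    have e₄ := mul_nonneg (sub_nonneg.2 hp₃) hc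
    linarith
  have ec := mul_nonneg (sub_nonneg.2 hp₅) hc
  -- The two expressions vanish on the same line, the one through p₁ and p₄.
  have split₁ : 0 ≤ 3 - 9 * α / 4 - 6 * β ∨ 0 ≤ α - 4 / 3 + 8 * β / 3 := by
    rcases le_total (3 - 9 * α / 4 - 6 * β) 0 with h | h
    · exact .inr (by linarith)
    · exact .inl h
  rcases split₁ with hs | hs
  · have e₁ := mul_nonneg hα (sub_nonneg.2 h₁)
    have e₂ := mul_nonneg (sub_nonneg.2 hβ) (sub_nonneg.2 h₄)
    have e₃ := mul_nonneg hs (sub_nonneg.2 h₅)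
    linarith
  -- The line 4α + 14β = 7 passes through p₂ and p₄.
  rcases le_total (4 * α + 14 * β) 7 with hs' | hs'
  · have e₁ := mul_nonneg (sub_nonneg.2 hs') (sub_nonneg.2 h₁)
    have e₂ := mul_nonneg hs (sub_nonneg.2 h₂)
    have e₃ := mul_nonneg (sub_nonneg.2 hp₆) (sub_nonneg.2 h₄)
    linarith
  · have e₁ := mul_nonneg (sub_nonneg.2 hp₂) (sub_nonneg.2 h₂)
    have e₂ := mul_nonneg (sub_nonneg.2 hs') (sub_nonneg.2 h₃)
    have e₃ := mul_nonneg (sub_nonneg.2 hp₄) (sub_nonneg.2 h₄)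
    linarith

/-- The bound for nonnegative first coordinate. -/
theorem SimpleGraph.Connected.polyhedronP_bound {V : Type*} [Fintype V] {G : SimpleGraph V}
    [DecidableRel G.Adj] (hG : G.Connected) (hsub : IsSubcubic G) {α β γ : ℝ}
    (hP : (α, β, γ) ∈ polyhedronP) (hα : 0 ≤ α) :
    α * numDegree G 3 + β * numDegree G 2 + γ * numDegree G 1 ≤ (matchingNumber G : ℝ) + 1 := by
  refine le_of_mem_polyhedronP hP hα (Nat.cast_nonneg _) (Nat.cast_nonneg _) ?_ ?_ ?_ ?_ ?_
  · exact_mod_cast hG.four_ninths_bound hsub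
  · exact_mod_cast hG.seven_sixteenths_bound hsub
  · exact_mod_cast hG.one_quarter_bound hsub
  · exact_mod_cast hG.one_half_bound hsub
  · exact_mod_cast hG.one_third_bound hsub

theorem corollary4 (α β γ : ℝ) (hP : (α, β, γ) ∈ polyhedronP) :
    (0 ≤ α → ∀ {V : Type*} [Fintype V] (G : SimpleGraph V) [DecidableRel G.Adj],
      G.Connected → IsSubcubic G →
        (matchingNumber G : ℝ) ≥
          α * numDegree G 3 + β * numDegree G 2 + γ * numDegree G 1 - 1) ∧
    (α < 0 → ∀ {V : Type*} [Fintype V] (G : SimpleGraph V) [DecidableRel G.Adj],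
      G.Connected → IsSubcubic G →
        (matchingNumber G : ℝ) ≥
          α * numDegree G 3 + β * numDegree G 2 + γ * numDegree G 1 - (2 * |α| + 1)) := by
  refine ⟨fun hα V _ G _ hG hsub => ?_, fun hα V _ G _ hG hsub => ?_⟩
  · linarith [hG.polyhedronP_bound hsub hP hα]
  · obtain ⟨-, hp₂, hp₃, -, hp₅, -⟩ := hP
    simp only at hp₂ hp₃ hp₅
    -- Trading n₃ for n₁ moves α into the last coordinate; the constraints on x₃ + x₁ and x₃ + x₂ +
    -- x₁ are unchanged by this.
    have hP' : ((0 : ℝ), β, γ + α) ∈ polyhedronP := by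
      refine ⟨?_, ?_, ?_, ?_, ?_, ?_⟩ <;> simp only <;> linarith
    have h := hG.polyhedronP_bound hsub hP' le_rfl
    have hn : (numDegree G 1 : ℝ) ≤ numDegree G 3 + 2 := by
      exact_mod_cast hG.numDegree_one_le hsub
    rw [abs_of_neg hα]
    linarith [mul_nonneg (neg_nonneg.2 hα.le) (sub_nonneg.2 hn)]
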